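/- Let $\Bbbk$ be an algebraically closed field of characteristic zero, let $n,m$ be natural numbers with $mn\ge 2$, and let $X=\mathrm{Mat}(n,m)\cong\mathbb A^{nm}$ be the affine variety of $n\times m$ matrices over $\Bbbk$, with coordinate ring $\Bbbk[X]=\Bbbk[x_{ij}]$. For a locally nilpotent $\Bbbk$-derivation $\partial$ of $\Bbbk[X]$ (a locally nilpotent vector field on $X$), the automorphisms $\exp(t\partial)=\sum_{i\ge 0}\frac{t^i}{i!}\partial^i$, $t\in\Bbbk$, form the one-parameter unipotent subgroup $H=\exp(\Bbbk\partial)$ of $\mathrm{Aut}(X)$; a replica of $H$ is a subgroup $\exp(\Bbbk f\partial)$ with $f\in\ker\partial$. For $k\ne l$ let $H_{kl}=I_n+\Bbbk E_{kl}$ act on $X$ by left multiplication and let $H^{kl}=I_m+\Bbbk E^{kl}$ act on $X$ by right multiplication, where $E_{kl}$ ($n\times n$) and $E^{kl}$ ($m\times m$) are the matrices with entry $1$ at the place $(k,l)$ and $0$ elsewhere; these subgroups are $\exp(\Bbbk\delta_{kl})$ and $\exp(\Bbbk\delta^{kl})$ for the locally nilpotent vector fields $\delta_{kl}(B)=E_{kl}B$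 and $\delta^{kl}(B)=BE^{kl}$. Let $G\subseteq\mathrm{Aut}(X)$ be the subgroup generated by all $H_{kl}$, all $H^{kl}$ ($k\neq l$) and all their replicas. Theorem 3.3. Let $B_1,\dots,B_N$ be pairwise distinct matrices in $\mathrm{Mat}(n,m)$ and let $B'_1,\dots,B'_N$ be pairwise distinct matrices in $\mathrm{Mat}(n,m)$ such that $\operatorname{rank}B_i=\operatorname{rank}B'_i$ for all $i$ and, in the case $m=n$, $\det B_i=\det B'_i$ for all $i$. Then there is an element $g\in G$ such that $g.B_i=B'_i$ for all $i=1,\dots,N$. -/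

import Mathlib

open MvPolynomial

section LocallyNilpotent

variable {k A : Type*} [Field k] [CommRing A] [Algebra k A]

/-- The iterated Leibniz rule. -/
theorem Derivation.iterate_mul_eq_sum (D : Derivation k A A) (n : ℕ) (a b : A) :
    D^[n] (a * b) =
      ∑ p ∈ Finset.HasAntidiagonal.antidiagonal n, n.choose p.1 • (D^[p.1] a * D^[p.2] b) := by
  induction n with
  | zero => simp
  | succ n ih =>
    rw [Function.iterate_succ_apply', ih, map_sum,
      Finset.sum_antidiagonal_choose_succ_nsmul (fun i j => D^[i] a * D^[j] b),
      ← Finset.sum_add_distrib]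
    refine Finset.sum_congr rfl fun p hp => ?_
    rw [← Nat.choose_symm_of_eq_add (Finset.HasAntidiagonal.mem_antidiagonal.mp hp).symm, ← smul_add, map_nsmul,
      Derivation.leibniz, Function.iterate_succ_apply', Function.iterate_succ_apply']
    simp only [smul_eq_mul]
    ring

theorem Derivation.iterate_eq_zero_of_le (D : Derivation k A A) {m n : ℕ} (h : m ≤ n) {a : A}
    (ha : D^[m] a = 0) : D^[n] a = 0 := by
  obtain ⟨j, rfl⟩ := Nat.exists_eq_add_of_le' h
  rw [Function.iterate_add_apply, ha, Function.iterate_fixed (map_zero D)]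

variable (k A) in
/-- A locally nilpotent `k`-derivation of the `k`-algebra `A`; for `A = 𝒪(X)` this is a locally
nilpotent vector field on the affine variety `X`. -/
structure LND where
  toDer : Derivation k A A
  locallyNilpotent : ∀ a : A, ∃ n : ℕ, toDer^[n] a = 0

namespace LND

variable (D : LND k A)

open Classical in
/-- The exponential `exp (t ∂) a = ∑ i, (t ^ i / i!) ∂ ^ i a`; the sum is cut off at the first
`n` with `∂ ^ n a = 0`, from which on all terms vanish. -/
noncomputable def expFun (t : k) (a : A) : A :=
  ∑ i ∈ Finset.range (Nat.find (D.locallyNilpotent a)),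
    (t ^ i * (i.factorial : k)⁻¹) • D.toDer^[i] a

theorem expFun_eq (t : k) (a : A) {n : ℕ} (hn : D.toDer^[n] a = 0) :
    D.expFun t a = ∑ i ∈ Finset.range n, (t ^ i * (i.factorial : k)⁻¹) • D.toDer^[i] a := by
  classical
  unfold expFun
  refine Finset.sum_subset (Finset.range_mono (Nat.find_min' _ hn)) fun i _ hi => ?_
  rw [Derivation.iterate_eq_zero_of_le _ (by simpa using hi)
    (Nat.find_spec (D.locallyNilpotent a)), smul_zero]

theorem expFun_add (t : k) (a b : A) : D.expFun t (a + b) = D.expFun t a + D.expFun t b := by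
  obtain ⟨m, hm⟩ := D.locallyNilpotent a
  obtain ⟨n, hn⟩ := D.locallyNilpotent b
  have h1 := D.toDer.iterate_eq_zero_of_le (le_max_left m n) hm
  have h2 := D.toDer.iterate_eq_zero_of_le (le_max_right m n) hn
  have hadd : ∀ i, D.toDer^[i] (a + b) = D.toDer^[i] a + D.toDer^[i] b := fun i =>
    iterate_map_add D.toDer i a b
  rw [D.expFun_eq t a h1, D.expFun_eq t b h2, D.expFun_eq t (a + b) (n := max m n)
    (by rw [hadd, h1, h2, add_zero]), ← Finset.sum_add_distrib]
  simp only [hadd, smul_add]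

theorem expFun_sum_poly (t : k) (a : A) {n : ℕ} (hn : D.toDer^[n] a = 0) :
    D.expFun t a = (∑ i ∈ Finset.range n,
      Polynomial.monomial i ((i.factorial : k)⁻¹ • D.toDer^[i] a)).eval (algebraMap k A t) := by
  rw [D.expFun_eq t a hn, Polynomial.eval_finsetSum]
  refine Finset.sum_congr rfl fun i _ => ?_
  rw [Polynomial.eval_monomial, ← map_pow, mul_comm _ (algebraMap k A _), ← Algebra.smul_def,
    smul_smul]

theorem coeff_poly (a : A) {n : ℕ} (hn : D.toDer^[n] a = 0) (j : ℕ) :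
    (∑ i ∈ Finset.range n,
      Polynomial.monomial i ((i.factorial : k)⁻¹ • D.toDer^[i] a)).coeff j =
        (j.factorial : k)⁻¹ • D.toDer^[j] a := by
  rw [Polynomial.finsetSum_coeff]
  simp only [Polynomial.coeff_monomial, Finset.sum_ite_eq', Finset.mem_range]
  split_ifs with h
  · rfl
  · rw [D.toDer.iterate_eq_zero_of_le (not_lt.mp h) hn, smul_zero]

theorem iterate_mul_eq_zero {a b : A} {m n : ℕ} (hm : D.toDer^[m] a = 0)
    (hn : D.toDer^[n] b = 0) : D.toDer^[m + n] (a * b) = 0 := by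
  rw [Derivation.iterate_mul_eq_sum]
  refine Finset.sum_eq_zero fun p hp => ?_
  have hp' := Finset.HasAntidiagonal.mem_antidiagonal.mp hp
  rcases le_or_gt m p.1 with h | h
  · rw [D.toDer.iterate_eq_zero_of_le h hm, zero_mul, smul_zero]
  · rw [D.toDer.iterate_eq_zero_of_le (by omega : n ≤ p.2) hn, mul_zero, smul_zero]

theorem expFun_mul [CharZero k] (t : k) (a b : A) :
    D.expFun t (a * b) = D.expFun t a * D.expFun t b := by
  obtain ⟨m, hm⟩ := D.locallyNilpotent a
  obtain ⟨n, hn⟩ := D.locallyNilpotent b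
  rw [D.expFun_sum_poly t a hm, D.expFun_sum_poly t b hn,
    D.expFun_sum_poly t (a * b) (D.iterate_mul_eq_zero hm hn), ← Polynomial.eval_mul]
  congr 1
  ext j
  rw [D.coeff_poly _ (D.iterate_mul_eq_zero hm hn), Polynomial.coeff_mul,
    Derivation.iterate_mul_eq_sum, Finset.smul_sum]
  refine Finset.sum_congr rfl fun p hp => ?_
  rw [D.coeff_poly _ hm, D.coeff_poly _ hn, smul_mul_smul_comm, ← Nat.cast_smul_eq_nsmul k,
    smul_smul]
  congr 1
  obtain rfl := Finset.HasAntidiagonal.mem_antidiagonal.mp hp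
  have h1 : (p.1.factorial : k) ≠ 0 := by exact_mod_cast p.1.factorial_ne_zero
  have h2 : (p.2.factorial : k) ≠ 0 := by exact_mod_cast p.2.factorial_ne_zero
  have h3 : ((p.1 + p.2).factorial : k) ≠ 0 := by exact_mod_cast (p.1 + p.2).factorial_ne_zero
  have h4 := Nat.add_choose_mul_factorial_mul_factorial p.1 p.2
  have h5 : ((p.1 + p.2).choose p.1 : k) * p.1.factorial * p.2.factorial
      = (p.1 + p.2).factorial := by rw [Nat.choose_symm_add]; exact_mod_cast h4
  field_simp
  linear_combination h5

theorem expFun_algebraMap (t c : k) : D.expFun t (algebraMap k A c) = algebraMap k A c := by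
  rw [D.expFun_eq t _ (n := 1) (by simp)]
  simp

theorem expFun_zero (a : A) : D.expFun 0 a = a := by
  obtain ⟨m, hm⟩ := D.locallyNilpotent a
  rw [D.expFun_eq 0 a (D.toDer.iterate_eq_zero_of_le (Nat.le_succ m) hm),
    Finset.sum_range_succ']
  simp

theorem expFun_expFun [CharZero k] (s t : k) (a : A) :
    D.expFun s (D.expFun t a) = D.expFun (s + t) a := by
  obtain ⟨m, hm⟩ := D.locallyNilpotent a
  set P : Polynomial A := ∑ i ∈ Finset.range m,
    Polynomial.monomial i ((i.factorial : k)⁻¹ • D.toDer^[i] a) with hP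
  have hder : ∀ i, D.toDer^[i] (D.expFun t a) = D.expFun t (D.toDer^[i] a) := by
    intro i
    have hi : D.toDer^[m] (D.toDer^[i] a) = 0 := by
      rw [← Function.iterate_add_apply]
      exact D.toDer.iterate_eq_zero_of_le (Nat.le_add_right m i) hm
    rw [D.expFun_eq t a hm, D.expFun_eq t _ hi]
    have := map_sum ((D.toDer : A →ₗ[k] A) ^ i)
      (fun j => (t ^ j * (j.factorial : k)⁻¹) • D.toDer^[j] a) (Finset.range m)
    simp only [map_smul, Module.End.pow_apply, Derivation.coeFn_coe] at this
    rw [this]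
    refine Finset.sum_congr rfl fun j _ => ?_
    rw [← Function.iterate_add_apply, ← Function.iterate_add_apply, add_comm]
  have hcoef : ∀ i, (Polynomial.taylor (algebraMap k A t) P).coeff i =
      (i.factorial : k)⁻¹ • D.toDer^[i] (D.expFun t a) := by
    intro i
    have hi : D.toDer^[m] (D.toDer^[i] a) = 0 := by
      rw [← Function.iterate_add_apply]
      exact D.toDer.iterate_eq_zero_of_le (Nat.le_add_right m i) hm
    rw [Polynomial.taylor_coeff, hder, D.expFun_sum_poly t _ hi, ← Polynomial.eval_smul]
    congr 1
    ext j
    rw [Polynomial.hasseDeriv_coeff, hP, D.coeff_poly _ hm, Polynomial.coeff_smul,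
      D.coeff_poly _ hi, ← Function.iterate_add_apply, smul_smul, ← nsmul_eq_mul,
      ← Nat.cast_smul_eq_nsmul k, smul_smul]
    congr 1
    have h1 : (i.factorial : k) ≠ 0 := by exact_mod_cast i.factorial_ne_zero
    have h2 : (j.factorial : k) ≠ 0 := by exact_mod_cast j.factorial_ne_zero
    have h3 : ((j + i).factorial : k) ≠ 0 := by exact_mod_cast (j + i).factorial_ne_zero
    have h4 := Nat.add_choose_mul_factorial_mul_factorial j i
    have h5 : ((j + i).choose i : k) * j.factorial * i.factorial
        = (j + i).factorial := by
      exact_mod_cast h4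
    field_simp
    linear_combination h5
  have hz : D.toDer^[m] (D.expFun t a) = 0 := by
    rw [hder, hm, ← map_zero (algebraMap k A), expFun_algebraMap]
  rw [D.expFun_sum_poly s _ hz, D.expFun_sum_poly (s + t) a hm, map_add, ← hP,
    ← Polynomial.taylor_eval]
  congr 1
  ext j
  rw [D.coeff_poly _ hz, hcoef]

/-- The one-parameter group `t ↦ exp (t ∂)` of automorphisms of `A`. -/
noncomputable def exp [CharZero k] : Multiplicative k →* (A ≃ₐ[k] A) where
  toFun t :=
    { toFun := D.expFun t.toAdd
      invFun := D.expFun (-t.toAdd)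
      left_inv := fun a => by rw [expFun_expFun, neg_add_cancel, expFun_zero]
      right_inv := fun a => by rw [expFun_expFun, add_neg_cancel, expFun_zero]
      map_mul' := D.expFun_mul _
      map_add' := D.expFun_add _
      commutes' := D.expFun_algebraMap _ }
  map_one' := AlgEquiv.ext fun a => D.expFun_zero a
  map_mul' s t := AlgEquiv.ext fun a => (D.expFun_expFun s.toAdd t.toAdd a).symm

/-- The one-parameter unipotent subgroup `exp (k ∂)`. -/
noncomputable def oneParameterSubgroup [CharZero k] : Subgroup (A ≃ₐ[k] A) :=
  D.exp.range

/-- The replica `f ∂` of `∂`, for `f ∈ ker ∂`. -/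
def replica (f : A) (hf : D.toDer f = 0) : LND k A where
  toDer := f • D.toDer
  locallyNilpotent a := by
    have h : ∀ n, (f • D.toDer)^[n] a = f ^ n * D.toDer^[n] a := by
      intro n
      induction n with
      | zero => simp
      | succ n ih =>
        rw [Function.iterate_succ_apply', ih, Function.iterate_succ_apply', Derivation.smul_apply,
          Derivation.leibniz, Derivation.leibniz_pow, hf]
        simp only [smul_eq_mul, mul_zero, nsmul_zero, add_zero]
        ring
    obtain ⟨n, hn⟩ := D.locallyNilpotent a
    exact ⟨n, by rw [h, hn, mul_zero]⟩

end LND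

/-- The group generated by the one-parameter unipotent subgroups `exp (k ∂)`, `∂ ∈ N`. -/
noncomputable def specialGroup [CharZero k] (N : Set (LND k A)) : Subgroup (A ≃ₐ[k] A) :=
  ⨆ D ∈ N, D.oneParameterSubgroup

end LocallyNilpotent

section Matrices

variable (k : Type*) [Field k] (n m : ℕ)

/-- The coordinate ring `k[x_ij]` of the affine space `Mat(n, m)`. -/
abbrev MatCoord : Type _ := MvPolynomial (Fin n × Fin m) k

variable {k n m}

theorem locallyNilpotent_mkDerivation (v : Fin n × Fin m → MatCoord k n m)
    (hv : ∀ p, mkDerivation k v (v p) = 0) (a : MatCoord k n m) :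
    ∃ N : ℕ, (mkDerivation k v)^[N] a = 0 := by
  induction a using MvPolynomial.induction_on with
  | C c => exact ⟨1, by simp⟩
  | add p q hp hq =>
    obtain ⟨i, hi⟩ := hp
    obtain ⟨j, hj⟩ := hq
    refine ⟨max i j, ?_⟩
    rw [iterate_map_add (mkDerivation k v),
      Derivation.iterate_eq_zero_of_le _ (le_max_left i j) hi,
      Derivation.iterate_eq_zero_of_le _ (le_max_right i j) hj, add_zero]
  | mul_X p x hp =>
    obtain ⟨i, hi⟩ := hp
    refine ⟨i + 2, ?_⟩
    have h2 : (mkDerivation k v)^[2] (X x : MatCoord k n m) = 0 := by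
      simp [hv]
    rw [Derivation.iterate_mul_eq_sum]
    refine Finset.sum_eq_zero fun q hq => ?_
    have hq' := Finset.HasAntidiagonal.mem_antidiagonal.mp hq
    rcases le_or_gt i q.1 with h | h
    · rw [Derivation.iterate_eq_zero_of_le _ h hi, zero_mul, smul_zero]
    · rw [Derivation.iterate_eq_zero_of_le _ (by omega : 2 ≤ q.2) h2, mul_zero, smul_zero]

/-- The vector field `δ_rs` on `Mat(n, m)` of the group `H_rs = I + k E_rs` (`r ≠ s`) acting by
left multiplication: its value at a matrix `B` is `E_rs B`. -/
noncomputable def rowLND (r s : Fin n) (h : r ≠ s) : LND k (MatCoord k n m) where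
  toDer := mkDerivation k fun p =>
    ((Matrix.single r s 1 : Matrix (Fin n) (Fin n) (MatCoord k n m)) * Matrix.mvPolynomialX (Fin n) (Fin m) k) p.1 p.2
  locallyNilpotent := locallyNilpotent_mkDerivation _ fun p => by
    by_cases hp : p.1 = r
    · simp [hp, Matrix.single_mul_apply_same, Matrix.mvPolynomialX, h.symm]
    · simp [hp]

/-- The vector field `δ^rs` on `Mat(n, m)` of the group `H^rs = I + k E^rs` (`r ≠ s`) acting by
right multiplication: its value at a matrix `B` is `B E^rs`. -/
noncomputable def colLND (r s : Fin m) (h : r ≠ s) : LND k (MatCoord k n m) where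
  toDer := mkDerivation k fun p =>
    (Matrix.mvPolynomialX (Fin n) (Fin m) k *
      (Matrix.single r s 1 : Matrix (Fin m) (Fin m) (MatCoord k n m))) p.1 p.2
  locallyNilpotent := locallyNilpotent_mkDerivation _ fun p => by
    by_cases hp : p.2 = s
    · simp [hp, Matrix.mvPolynomialX, h]
    · simp [hp]

variable (k n m) in
/-- The vector fields of the elementary one-parameter unipotent subgroups: all replicas of all
`δ_rs` and `δ^rs` (including, with `f = 1`, these fields themselves). -/
def elementaryLND : Set (LND k (MatCoord k n m)) :=
  {D | ∃ (r s : Fin n) (h : r ≠ s) (f : MatCoord k n m) (hf : (rowLND r s h).toDer f = 0),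
      D = (rowLND r s h).replica f hf} ∪
  {D | ∃ (r s : Fin m) (h : r ≠ s) (f : MatCoord k n m) (hf : (colLND r s h).toDer f = 0),
      D = (colLND r s h).replica f hf}

variable (k n m) in
/-- The group `G` generated by the elementary one-parameter unipotent subgroups. An automorphism
of the variety `Mat(n, m)` is recorded by its comorphism, an automorphism of `k[x_ij]`. -/
noncomputable def elementaryGroup [CharZero k] : Subgroup (MatCoord k n m ≃ₐ[k] MatCoord k n m) :=
  specialGroup (elementaryLND k n m)

/-- The self-map of `Mat(n, m)` with comorphism `g`: the `(i, j)` entry of the image of `B` is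
the value at `B` of the polynomial `g x_ij`. (Comorphisms compose in the opposite order, so a
group of comorphisms and its opposite give the same set of self-maps.) -/
noncomputable def applyAut (g : MatCoord k n m ≃ₐ[k] MatCoord k n m)
    (B : Matrix (Fin n) (Fin m) k) : Matrix (Fin n) (Fin m) k :=
  Matrix.of fun i j => eval (fun p : Fin n × Fin m => B p.1 p.2) (g (X (i, j)))

end Matrices

/-! ### Polynomial interpolation in a restricted set of coordinates -/

section Interpolation

variable {k : Type*} [Field k]

/-! The vector field of an operation on row `r` kills every polynomial in the entries of the other
rows, and the exponential of the resulting replica adds to row `r` a multiple of row `s` with that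
polynomial as coefficient; columns behave likewise. Since polynomials take prescribed values at
finitely many points, `G` induces on such points every `ElementaryMap`, whose coefficients are
arbitrary functions, for instance indicator functions (`ElementaryMap.exists_applyAut_eq`). What
remains is a combinatorial problem about these maps.

Gaussian elimination by transvections joins each `B i` to `B' i` by an `ElementaryPath`
(`ElementaryPath.of_rank_eq`). The points are put in place one at a time, so the core is
`exists_elementaryMap_fixing`: carry `A` along a path to `A'` while fixing a finite set `S`. An
operation whose coefficient is supported near the current matrix `M` disturbs `C ∈ S` only if `C`
agrees with `M` outside the row or column being changed. To exclude this, `S` is first displaced by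
a shear `B + t w ψ B` with `ψ w = 0`, localized so as to fix `A`. For all but finitely many `t` no
step of the path then disturbs the displaced points. Once `A` has reached `A'`, the inverse shear,
localized so as to fix `A'`, brings `S` back. -/

theorem MvPolynomial.exists_eval_eq_on_finset {σ : Type*} (S : Finset (σ → k)) (F : (σ → k) → k) :
    ∃ p : MvPolynomial σ k, ∀ a ∈ S, eval a p = F a := by
  classical
  induction S using Finset.induction_on with
  | empty => exact ⟨0, by simp⟩
  | insert a S ha ih =>
    obtain ⟨p, hp⟩ := ih
    have hsep : ∀ b : σ → k, ∃ q : MvPolynomial σ k, b ≠ a → eval b q = 0 ∧ eval a q ≠ 0 := by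
      intro b
      by_cases hb : b = a
      · exact ⟨0, fun h => absurd hb h⟩
      · obtain ⟨i, hi⟩ := Function.ne_iff.mp hb
        exact ⟨X i - C (b i), fun _ => ⟨by simp, by simpa [sub_eq_zero] using Ne.symm hi⟩⟩
    choose q hq using hsep
    have hne : ∀ b ∈ S, b ≠ a := fun b hb h => ha (h ▸ hb)
    have he : eval a (∏ b ∈ S, q b) ≠ 0 := by
      rw [map_prod]
      exact Finset.prod_ne_zero_iff.mpr fun b hb => (hq b (hne b hb)).2
    refine ⟨p + C ((F a - eval a p) / eval a (∏ b ∈ S, q b)) * ∏ b ∈ S, q b, fun b hb => ?_⟩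
    rcases Finset.mem_insert.mp hb with rfl | hb
    · rw [map_add, map_mul, eval_C, div_mul_cancel₀ _ he, add_sub_cancel]
    · rw [map_add, map_mul, map_prod (eval b),
        Finset.prod_eq_zero (f := fun c => eval b (q c)) hb (hq b (hne b hb)).1, mul_zero, add_zero, hp b hb]

/-- Interpolation at finitely many points of a function of the coordinates satisfying `P`. -/
theorem MvPolynomial.exists_eval_eq_of_dependsOn {σ ι : Type*} [Finite ι] (P : σ → Prop)
    (F : (σ → k) → k) (hF : ∀ a b : σ → k, (∀ i, P i → a i = b i) → F a = F b) (a : ι → σ → k) :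
    ∃ p : MvPolynomial σ k, (∀ i ∈ p.vars, P i) ∧ ∀ j, eval (a j) p = F (a j) := by
  classical
  have := Fintype.ofFinite ι
  -- Interpolate after restriction to the coordinates in `P`. Filling the others with `0` is
  -- harmless because `F` ignores them.
  obtain ⟨p, hp⟩ := MvPolynomial.exists_eval_eq_on_finset
    (Finset.univ.image fun (j : ι) (i : {i // P i}) => a j i)
    (fun b => F fun i => if h : P i then b ⟨i, h⟩ else 0)
  refine ⟨rename Subtype.val p, fun i hi => ?_, fun j => ?_⟩
  · have := vars_rename _ _ hi
    obtain ⟨x, -, rfl⟩ := Finset.mem_image.mp this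
    exact x.2
  · rw [eval_rename]
    refine (hp _ (Finset.mem_image_of_mem _ (Finset.mem_univ j))).trans (hF _ _ fun i hi => ?_)
    simp [hi]

end Interpolation

/-! ### Operations with variable coefficients and their realization in `G` -/

section ElementaryMaps

variable {k : Type*} [Field k] {n m : ℕ}

/-- The self-maps of `Mat(n, m)` generated by the elementary row and column operations whose
coefficient is an arbitrary function of the matrix that does not depend on the row or column being
changed. -/
inductive ElementaryMap :
    (Matrix (Fin n) (Fin m) k → Matrix (Fin n) (Fin m) k) → Prop
  | id : ElementaryMap fun B => B
  | row {g} (hg : ElementaryMap g) (r s : Fin n) (h : r ≠ s) (F : Matrix (Fin n) (Fin m) k → k)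
      (hF : ∀ A B, (∀ i q, i ≠ r → A i q = B i q) → F A = F B) :
      ElementaryMap fun B => Matrix.transvection r s (F (g B)) * g B
  | col {g} (hg : ElementaryMap g) (r s : Fin m) (h : r ≠ s) (F : Matrix (Fin n) (Fin m) k → k)
      (hF : ∀ A B, (∀ i q, q ≠ s → A i q = B i q) → F A = F B) :
      ElementaryMap fun B => g B * Matrix.transvection r s (F (g B))

theorem ElementaryMap.comp {f g : Matrix (Fin n) (Fin m) k → Matrix (Fin n) (Fin m) k}
    (hf : ElementaryMap f) (hg : ElementaryMap g) : ElementaryMap fun B => f (g B) := by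
  induction hf with
  | id => exact hg
  | row _ r s h F hF ih => exact ih.row r s h F hF
  | col _ r s h F hF ih => exact ih.col r s h F hF

theorem ElementaryMap.transpose {f : Matrix (Fin n) (Fin m) k → Matrix (Fin n) (Fin m) k}
    (hf : ElementaryMap f) :
    ElementaryMap fun B : Matrix (Fin m) (Fin n) k => (f B.transpose).transpose := by
  induction hf with
  | id => exact .id
  | row _ r s h F hF ih =>
    convert ih.col s r h.symm (fun A => F A.transpose)
      (fun A B hAB => hF _ _ fun i q hi => hAB q i hi) using 2
    simp [Matrix.transvection, Matrix.transpose_mul]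
  | col _ r s h F hF ih =>
    convert ih.row s r h.symm (fun A => F A.transpose)
      (fun A B hAB => hF _ _ fun i q hi => hAB q i hi) using 2
    simp [Matrix.transvection, Matrix.transpose_mul]

theorem applyAut_one (B : Matrix (Fin n) (Fin m) k) : applyAut 1 B = B := by
  ext i j
  simp [applyAut]

/-- Both sides are algebra homomorphisms in `f` and agree on coordinates: `g` is indeed the
comorphism of `applyAut g`. -/
theorem eval_apply_aut (g : MatCoord k n m ≃ₐ[k] MatCoord k n m) (B : Matrix (Fin n) (Fin m) k)
    (f : MatCoord k n m) :
    eval (fun p => B p.1 p.2) (g f) = eval (fun p => applyAut g B p.1 p.2) f := by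
  have : (aeval (fun p : Fin n × Fin m => B p.1 p.2)).comp (g : MatCoord k n m →ₐ[k] MatCoord k n m)
      = aeval (fun p => applyAut g B p.1 p.2) := by
    refine MvPolynomial.algHom_ext fun p => ?_
    simp [applyAut, aeval_eq_eval]
  simpa [aeval_eq_eval] using DFunLike.congr_fun this f

theorem applyAut_mul (g h : MatCoord k n m ≃ₐ[k] MatCoord k n m) (B : Matrix (Fin n) (Fin m) k) :
    applyAut (g * h) B = applyAut h (applyAut g B) := by
  ext i j
  simp only [applyAut, Matrix.of_apply, AlgEquiv.mul_apply]
  rw [eval_apply_aut]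
  rfl

variable [CharZero k]

theorem LND.exp_mem_specialGroup {A : Type*} [CommRing A] [Algebra k A] {N : Set (LND k A)}
    {D : LND k A} (hD : D ∈ N) (t : k) : D.exp (Multiplicative.ofAdd t) ∈ specialGroup N :=
  Subgroup.mem_iSup_of_mem D (Subgroup.mem_iSup_of_mem hD ⟨_, rfl⟩)

theorem LND.exp_one_apply_of_sq {A : Type*} [CommRing A] [Algebra k A] (D : LND k A) {a : A}
    (ha : D.toDer (D.toDer a) = 0) : D.exp (Multiplicative.ofAdd 1) a = a + D.toDer a := by
  change D.expFun 1 a = _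
  rw [D.expFun_eq 1 a (n := 2) ha]
  simp [Finset.sum_range_succ]

/-- Interpolating `F` by a polynomial in the entries outside row `r` gives an element of the kernel,
hence a replica. Applied twice it kills each coordinate, so its time-one exponential is the identity
plus the replica there. -/
theorem exists_applyAut_eq_row {ι : Type*} [Finite ι] {r s : Fin n} (h : r ≠ s)
    (F : Matrix (Fin n) (Fin m) k → k)
    (hF : ∀ A B, (∀ i q, i ≠ r → A i q = B i q) → F A = F B)
    (B : ι → Matrix (Fin n) (Fin m) k) :
    ∃ g ∈ elementaryGroup k n m, ∀ j,
      applyAut g (B j) = Matrix.transvection r s (F (B j)) * B j := by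
  obtain ⟨f, hvars, hf⟩ := MvPolynomial.exists_eval_eq_of_dependsOn
    (fun p : Fin n × Fin m => p.1 ≠ r) (fun a => F (Matrix.of fun i q => a (i, q)))
    (fun a b hab => hF _ _ fun i q hi => hab (i, q) hi) (fun j p => B j p.1 p.2)
  have hker : (rowLND (k := k) (m := m) r s h).toDer f = 0 := by
    refine derivation_eq_zero_of_forall_mem_vars fun p hp => ?_
    simp [rowLND, mkDerivation_X, hvars p hp]
  refine ⟨_, LND.exp_mem_specialGroup (.inl ⟨r, s, h, f, hker, rfl⟩) 1, fun j => ?_⟩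
  ext i q
  have hX : ((rowLND r s h).replica f hker).toDer (X (i, q)) =
      if i = r then f * X (s, q) else 0 := by
    split_ifs with hi <;>
      simp [LND.replica, rowLND, mkDerivation_X, hi, Matrix.mvPolynomialX]
  have hX2 : ((rowLND r s h).replica f hker).toDer
      (((rowLND r s h).replica f hker).toDer (X (i, q))) = 0 := by
    rw [hX]
    split_ifs with hi
    · rw [Derivation.leibniz]
      simp [LND.replica, hker]
      simp [rowLND, mkDerivation_X, h.symm]
    · simp
  rw [applyAut, Matrix.of_apply, LND.exp_one_apply_of_sq _ hX2, hX]
  have hfj : eval (fun p : Fin n × Fin m => B j p.1 p.2) f = F (B j) := hf j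
  by_cases hi : i = r
  · subst hi
    simp [hfj]
  · simp [hi]

theorem exists_applyAut_eq_col {ι : Type*} [Finite ι] {r s : Fin m} (h : r ≠ s)
    (F : Matrix (Fin n) (Fin m) k → k)
    (hF : ∀ A B, (∀ i q, q ≠ s → A i q = B i q) → F A = F B)
    (B : ι → Matrix (Fin n) (Fin m) k) :
    ∃ g ∈ elementaryGroup k n m, ∀ j,
      applyAut g (B j) = B j * Matrix.transvection r s (F (B j)) := by
  obtain ⟨f, hvars, hf⟩ := MvPolynomial.exists_eval_eq_of_dependsOn
    (fun p : Fin n × Fin m => p.2 ≠ s) (fun a => F (Matrix.of fun i q => a (i, q)))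
    (fun a b hab => hF _ _ fun i q hi => hab (i, q) hi) (fun j p => B j p.1 p.2)
  have hker : (colLND (k := k) (n := n) r s h).toDer f = 0 := by
    refine derivation_eq_zero_of_forall_mem_vars fun p hp => ?_
    simp [colLND, mkDerivation_X, hvars p hp]
  refine ⟨_, LND.exp_mem_specialGroup (.inr ⟨r, s, h, f, hker, rfl⟩) 1, fun j => ?_⟩
  ext i q
  have hX : ((colLND r s h).replica f hker).toDer (X (i, q)) =
      if q = s then f * X (i, r) else 0 := by
    split_ifs with hi <;>
      simp [LND.replica, colLND, mkDerivation_X, hi, Matrix.mvPolynomialX]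
  have hX2 : ((colLND r s h).replica f hker).toDer
      (((colLND r s h).replica f hker).toDer (X (i, q))) = 0 := by
    rw [hX]
    split_ifs with hi
    · rw [Derivation.leibniz]
      simp [LND.replica, hker]
      simp [colLND, mkDerivation_X, h]
    · simp
  rw [applyAut, Matrix.of_apply, LND.exp_one_apply_of_sq _ hX2, hX]
  have hfj : eval (fun p : Fin n × Fin m => B j p.1 p.2) f = F (B j) := hf j
  by_cases hi : q = s
  · subst hi
    simp [hfj]
  · simp [hi]

/-- On finitely many points every elementary map is induced by an element of the group `G`. -/
theorem ElementaryMap.exists_applyAut_eq {ι : Type*} [Finite ι]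
    {f : Matrix (Fin n) (Fin m) k → Matrix (Fin n) (Fin m) k} (hf : ElementaryMap f)
    (B : ι → Matrix (Fin n) (Fin m) k) :
    ∃ g ∈ elementaryGroup k n m, ∀ j, applyAut g (B j) = f (B j) := by
  induction hf with
  | id => exact ⟨1, one_mem _, fun j => applyAut_one _⟩
  | @row f _ r s h F hF ih =>
    obtain ⟨g, hg, hgB⟩ := ih
    obtain ⟨g', hg', hgB'⟩ := exists_applyAut_eq_row h F hF fun j => f (B j)
    exact ⟨g * g', mul_mem hg hg', fun j => by rw [applyAut_mul, hgB, hgB']⟩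
  | @col f _ r s h F hF ih =>
    obtain ⟨g, hg, hgB⟩ := ih
    obtain ⟨g', hg', hgB'⟩ := exists_applyAut_eq_col h F hF fun j => f (B j)
    exact ⟨g * g', mul_mem hg hg', fun j => by rw [applyAut_mul, hgB, hgB']⟩

end ElementaryMaps

/-! ### Gaussian elimination by transvections -/

section Elimination

variable {k : Type*} [Field k]

/-- Two matrices differ by a single elementary row or column operation. -/
def ElementaryStep {n m : ℕ} (A A' : Matrix (Fin n) (Fin m) k) : Prop :=
  (∃ r s : Fin n, r ≠ s ∧ ∃ c : k, A' = Matrix.transvection r s c * A) ∨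
    ∃ r s : Fin m, r ≠ s ∧ ∃ c : k, A' = A * Matrix.transvection r s c

/-- Two matrices are related by a chain of elementary row and column operations. -/
def ElementaryPath {n m : ℕ} : Matrix (Fin n) (Fin m) k → Matrix (Fin n) (Fin m) k → Prop :=
  Relation.ReflTransGen ElementaryStep

variable {n m : ℕ}

theorem ElementaryPath.row (A : Matrix (Fin n) (Fin m) k) {r s : Fin n} (h : r ≠ s) (c : k) :
    ElementaryPath A (Matrix.transvection r s c * A) :=
  .single (.inl ⟨r, s, h, c, rfl⟩)

theorem ElementaryPath.col (A : Matrix (Fin n) (Fin m) k) {r s : Fin m} (h : r ≠ s) (c : k) :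
    ElementaryPath A (A * Matrix.transvection r s c) :=
  .single (.inr ⟨r, s, h, c, rfl⟩)

theorem ElementaryPath.trans {A A' A'' : Matrix (Fin n) (Fin m) k} (h : ElementaryPath A A')
    (h' : ElementaryPath A' A'') : ElementaryPath A A'' :=
  Relation.ReflTransGen.trans h h'

theorem ElementaryStep.symm {A A' : Matrix (Fin n) (Fin m) k} (h : ElementaryStep A A') :
    ElementaryStep A' A := by
  rcases h with ⟨r, s, h, c, rfl⟩ | ⟨r, s, h, c, rfl⟩
  · exact .inl ⟨r, s, h, -c, by
      rw [← Matrix.mul_assoc, Matrix.transvection_mul_transvection_same _ _ h]; simp⟩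
  · exact .inr ⟨r, s, h, -c, by
      rw [Matrix.mul_assoc, Matrix.transvection_mul_transvection_same _ _ h]; simp⟩

theorem ElementaryPath.symm {A A' : Matrix (Fin n) (Fin m) k} (h : ElementaryPath A A') :
    ElementaryPath A' A :=
  by
  have : Std.Symm (ElementaryStep (k := k) (n := n) (m := m)) := ⟨fun _ _ => ElementaryStep.symm⟩
  exact Relation.ReflTransGen.stdSymm.symm _ _ h

theorem ElementaryStep.transpose {A A' : Matrix (Fin n) (Fin m) k} (h : ElementaryStep A A') :
    ElementaryStep A.transpose A'.transpose := by
  rcases h with ⟨r, s, h, c, rfl⟩ | ⟨r, s, h, c, rfl⟩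
  · exact .inr ⟨s, r, h.symm, c, by simp [Matrix.transvection, Matrix.transpose_mul]⟩
  · exact .inl ⟨s, r, h.symm, c, by simp [Matrix.transvection, Matrix.transpose_mul]⟩

theorem ElementaryPath.transpose {A A' : Matrix (Fin n) (Fin m) k} (h : ElementaryPath A A') :
    ElementaryPath A.transpose A'.transpose :=
  Relation.ReflTransGen.lift Matrix.transpose (fun _ _ => ElementaryStep.transpose) _ _ h

theorem ElementaryStep.rank_eq {A A' : Matrix (Fin n) (Fin m) k} (h : ElementaryStep A A') :
    A.rank = A'.rank := by
  rcases h with ⟨r, s, h, c, rfl⟩ | ⟨r, s, h, c, rfl⟩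
  · rw [Matrix.rank_mul_eq_right_of_det_ne_zero]
    simp [Matrix.det_transvection_of_ne _ _ h]
  · rw [Matrix.rank_mul_eq_left_of_det_ne_zero]
    simp [Matrix.det_transvection_of_ne _ _ h]

theorem ElementaryPath.rank_eq {A A' : Matrix (Fin n) (Fin m) k} (h : ElementaryPath A A') :
    A.rank = A'.rank := by
  induction h with
  | refl => rfl
  | tail _ hs ih => exact ih.trans hs.rank_eq

theorem ElementaryPath.det_eq {A A' : Matrix (Fin n) (Fin n) k} (h : ElementaryPath A A') :
    A.det = A'.det := by
  induction h with
  | refl => rfl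
  | tail _ hs ih =>
    rcases hs with ⟨r, s, h, c, rfl⟩ | ⟨r, s, h, c, rfl⟩ <;>
      simp [Matrix.det_transvection_of_ne _ _ h, ih]

/-- The block diagonal matrix with blocks `1` and `M`. -/
def oneBlock (M : Matrix (Fin n) (Fin m) k) : Matrix (Fin (n + 1)) (Fin (m + 1)) k :=
  Matrix.of (Fin.cons (Fin.cons 1 0) fun i => Fin.cons 0 (M i))

@[simp] theorem oneBlock_zero_zero (M : Matrix (Fin n) (Fin m) k) : oneBlock M 0 0 = 1 := rfl

@[simp] theorem oneBlock_zero_succ (M : Matrix (Fin n) (Fin m) k) (j : Fin m) :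
    oneBlock M 0 j.succ = 0 := rfl

@[simp] theorem oneBlock_succ_zero (M : Matrix (Fin n) (Fin m) k) (i : Fin n) :
    oneBlock M i.succ 0 = 0 := rfl

@[simp] theorem oneBlock_succ_succ (M : Matrix (Fin n) (Fin m) k) (i : Fin n) (j : Fin m) :
    oneBlock M i.succ j.succ = M i j := rfl

theorem oneBlock_mul_transvection (M : Matrix (Fin n) (Fin m) k) (r s : Fin m) (c : k) :
    oneBlock (M * Matrix.transvection r s c) =
      oneBlock M * Matrix.transvection r.succ s.succ c := by
  ext i j
  by_cases hj : j = s.succ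
  · subst hj
    cases i using Fin.cases <;> simp
  · rw [Matrix.mul_transvection_apply_of_ne _ _ _ _ hj]
    cases i using Fin.cases <;> cases j using Fin.cases <;> try rfl
    rw [oneBlock_succ_succ, oneBlock_succ_succ, Matrix.mul_transvection_apply_of_ne]
    exact fun h => hj (h ▸ rfl)

theorem oneBlock_transvection_mul (M : Matrix (Fin n) (Fin m) k) (r s : Fin n) (c : k) :
    oneBlock (Matrix.transvection r s c * M) =
      Matrix.transvection r.succ s.succ c * oneBlock M := by
  ext i j
  by_cases hi : i = r.succ
  · subst hi
    cases j using Fin.cases <;> simp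
  · rw [Matrix.transvection_mul_apply_of_ne _ _ _ _ hi]
    cases i using Fin.cases <;> cases j using Fin.cases <;> try rfl
    rw [oneBlock_succ_succ, oneBlock_succ_succ, Matrix.transvection_mul_apply_of_ne]
    exact fun h => hi (h ▸ rfl)

theorem ElementaryStep.oneBlock {M M' : Matrix (Fin n) (Fin m) k} (h : ElementaryStep M M') :
    ElementaryStep (oneBlock M) (oneBlock M') := by
  rcases h with ⟨r, s, h, c, rfl⟩ | ⟨r, s, h, c, rfl⟩
  · exact .inl ⟨r.succ, s.succ, by simpa using h, c, oneBlock_transvection_mul M r s c⟩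
  · exact .inr ⟨r.succ, s.succ, by simpa using h, c, oneBlock_mul_transvection M r s c⟩

theorem ElementaryPath.oneBlock {M M' : Matrix (Fin n) (Fin m) k} (h : ElementaryPath M M') :
    ElementaryPath (oneBlock M) (oneBlock M') :=
  Relation.ReflTransGen.lift _root_.oneBlock (fun _ _ => ElementaryStep.oneBlock) _ _ h

theorem det_oneBlock (M : Matrix (Fin n) (Fin n) k) : (oneBlock M).det = M.det := by
  rw [Matrix.det_succ_row_zero, Fin.sum_univ_succ]
  simp
  rfl

/-- The kernel is `0 × ker M`, so rank-nullity on both sides gives the count. -/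
theorem rank_oneBlock (M : Matrix (Fin n) (Fin m) k) : (oneBlock M).rank = M.rank + 1 := by
  have hker : LinearMap.ker (oneBlock M).mulVecLin =
      (LinearMap.ker M.mulVecLin).map
        ((Fin.consLinearEquiv k fun _ : Fin (m + 1) => k).toLinearMap ∘ₗ LinearMap.inr k k _) := by
    ext v
    obtain ⟨a, w, rfl⟩ : ∃ (a : k) (w : Fin m → k), v = Fin.cons a w :=
      ⟨v 0, fun i => v i.succ, (Fin.cons_self_tail v).symm⟩
    simp only [LinearMap.mem_ker, Matrix.mulVecLin_apply, Submodule.mem_map]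
    have h0 : (oneBlock M).mulVec (Fin.cons a w) = Fin.cons a (M.mulVec w) := by
      ext i
      cases i using Fin.cases <;>
        simp [Matrix.mulVec, dotProduct, Fin.sum_univ_succ]
    rw [h0]
    constructor
    · intro h
      refine ⟨w, funext fun i => by simpa using congrFun h i.succ, ?_⟩
      have : a = 0 := by simpa using congrFun h 0
      subst this
      rfl
    · rintro ⟨u, hu, h⟩
      have h' : (Fin.cons 0 u : Fin (m + 1) → k) = Fin.cons a w := h
      obtain ⟨rfl, rfl⟩ := Fin.cons_inj.mp h'
      rw [hu]
      ext i
      cases i using Fin.cases <;> simp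
  have hinj : Function.Injective
      ((Fin.consLinearEquiv k fun _ : Fin (m + 1) => k).toLinearMap ∘ₗ
        LinearMap.inr k k (Fin m → k)) :=
    (Fin.consLinearEquiv k fun _ : Fin (m + 1) => k).injective.comp LinearMap.inr_injective
  have h1 := (oneBlock M).mulVecLin.finrank_range_add_finrank_ker
  have h2 := M.mulVecLin.finrank_range_add_finrank_ker
  rw [hker, LinearEquiv.finrank_eq (Submodule.equivMapOfInjective _ hinj _).symm] at h1
  simp only [Module.finrank_fin_fun] at h1 h2
  change (oneBlock M).rank + _ = _ at h1
  change M.rank + _ = _ at h2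
  omega

theorem eq_zero_of_rank_eq_zero {A : Matrix (Fin n) (Fin m) k} (h : A.rank = 0) : A = 0 := by
  have : A.mulVecLin = 0 := LinearMap.range_eq_bot.mp (Submodule.finrank_eq_zero.mp h)
  ext i j
  simpa using congrFun (LinearMap.congr_fun this (Pi.single j 1)) i

/-- The pivot clears the first column without touching the first row. The same argument on the
transpose then clears the first row and keeps the column cleared. -/
theorem exists_oneBlock_of_zero_zero {A : Matrix (Fin (n + 1)) (Fin (m + 1)) k} (hA : A 0 0 = 1) :
    ∃ M, ElementaryPath A (oneBlock M) := by
  have hcol : ∀ {n m : ℕ} (A : Matrix (Fin (n + 1)) (Fin (m + 1)) k), A 0 0 = 1 →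
      ∀ S : Finset (Fin n), ∃ A' : Matrix (Fin (n + 1)) (Fin (m + 1)) k, ElementaryPath A A' ∧ (∀ q, A' 0 q = A 0 q) ∧
        ∀ i ∈ S, A' i.succ 0 = 0 := by
    intro n m A hA S
    induction S using Finset.induction_on with
    | empty => exact ⟨A, .refl, fun _ => rfl, by simp⟩
    | insert i S _ ih =>
      obtain ⟨A', hp, h0, hS⟩ := ih
      refine ⟨_, hp.trans (.row A' (Fin.succ_ne_zero i) (-A' i.succ 0)), ?_, ?_⟩
      · intro q
        rw [Matrix.transvection_mul_apply_of_ne _ _ _ _ (Fin.succ_ne_zero i).symm, h0]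
      · intro j hj
        by_cases hji : j = i
        · subst hji
          simp [h0, hA]
        · rw [Matrix.transvection_mul_apply_of_ne _ _ _ _ (by simpa using hji)]
          exact hS j ((Finset.mem_insert.mp hj).resolve_left hji)
  obtain ⟨A', hp, h0, hz⟩ := hcol A hA Finset.univ
  obtain ⟨T, hp', h0', hz'⟩ := hcol A'.transpose (by simp [h0, hA]) Finset.univ
  refine ⟨Matrix.of fun i j => T j.succ i.succ, hp.trans ?_⟩
  suffices h : oneBlock (Matrix.of fun i j => T j.succ i.succ) = T.transpose from
    h ▸ hp'.transpose
  ext i j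
  have hT : ∀ i : Fin (n + 1), T 0 i = A' i 0 := fun i => h0' i
  cases i using Fin.cases <;> cases j using Fin.cases <;>
    simp [hT, hz, hz', h0, hA]

/-- Scaling a row is not available, so the pivot is made `1` by adding a multiple of another row
with nonzero first entry. If needed, the top row is first added to the last one; this is where a
second row is used. -/
theorem exists_path_zero_zero_of_col {A : Matrix (Fin (n + 1)) (Fin (m + 1)) k} (hn : 0 < n)
    {i : Fin (n + 1)} (hi : A i 0 ≠ 0) : ∃ A', ElementaryPath A A' ∧ A' 0 0 = 1 := by
  have key : ∀ (A : Matrix (Fin (n + 1)) (Fin (m + 1)) k) (i : Fin (n + 1)), i ≠ 0 → A i 0 ≠ 0 →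
      ∃ A', ElementaryPath A A' ∧ A' 0 0 = 1 := fun A i h0 hi =>
    ⟨_, .row A h0.symm ((1 - A 0 0) / A i 0), by simp [hi]⟩
  by_cases h0 : i = 0
  · subst h0
    by_cases h1 : A (Fin.last n) 0 = 0
    · have hl : Fin.last n ≠ 0 := by simpa [Fin.ext_iff] using hn.ne'
      obtain ⟨A', hA', h⟩ := key (Matrix.transvection (Fin.last n) 0 (1 : k) * A) _ hl (by simp [h1, hi])
      exact ⟨A', (ElementaryPath.row A hl 1).trans hA', h⟩
    · exact key A _ (by simpa [Fin.ext_iff] using hn.ne') h1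
  · exact key A i h0 hi

theorem exists_path_zero_zero {A : Matrix (Fin (n + 1)) (Fin (m + 1)) k} (hnm : 0 < n ∨ 0 < m)
    (hA : A ≠ 0) : ∃ A', ElementaryPath A A' ∧ A' 0 0 = 1 := by
  have key : ∀ {n m : ℕ} {A : Matrix (Fin (n + 1)) (Fin (m + 1)) k}, 0 < n → A ≠ 0 →
      ∃ A', ElementaryPath A A' ∧ A' 0 0 = 1 := by
    intro n m A hn hA
    by_cases h : ∃ i, A i 0 ≠ 0
    · exact exists_path_zero_zero_of_col hn h.choose_spec
    · push Not at h
      obtain ⟨i, j, hij⟩ : ∃ i j, A i j ≠ 0 := by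
        by_contra! h'
        exact hA (Matrix.ext h')
      have hj : j ≠ 0 := fun h' => hij (h' ▸ h i)
      obtain ⟨A', hA', h'⟩ := exists_path_zero_zero_of_col hn
        (A := A * Matrix.transvection j 0 (1 : k)) (i := i) (by simp [h, hij])
      exact ⟨A', (ElementaryPath.col A hj 1).trans hA', h'⟩
  rcases hnm with h | h
  · exact key h hA
  · obtain ⟨A', hA', h'⟩ := key (A := A.transpose) h (by simpa using hA)
    exact ⟨A'.transpose, hA'.transpose, h'⟩

theorem exists_path_oneBlock {A : Matrix (Fin (n + 1)) (Fin (m + 1)) k} (hnm : 0 < n ∨ 0 < m)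
    (hA : A ≠ 0) : ∃ M, ElementaryPath A (oneBlock M) := by
  obtain ⟨A', hA', h⟩ := exists_path_zero_zero hnm hA
  obtain ⟨M, hM⟩ := exists_oneBlock_of_zero_zero h
  exact ⟨M, hA'.trans hM⟩

/-- Matrices of the same size, rank and, if square, determinant are related by elementary row and
column operations. -/
theorem ElementaryPath.of_rank_eq (A A' : Matrix (Fin n) (Fin m) k) (hrank : A.rank = A'.rank)
    (hdet : ∀ h : n = m,
      (A.submatrix id (Fin.cast h)).det = (A'.submatrix id (Fin.cast h)).det) :
    ElementaryPath A A' := by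
  induction n generalizing m with
  | zero => rw [Subsingleton.elim A A']; exact .refl
  | succ n ih =>
    cases m with
    | zero => rw [Subsingleton.elim A A']; exact .refl
    | succ m =>
      by_cases hA : A = 0
      · subst hA
        rw [eq_zero_of_rank_eq_zero (hrank.symm.trans Matrix.rank_zero)]
        exact .refl
      have hA' : A' ≠ 0 := by
        rintro rfl
        exact hA (eq_zero_of_rank_eq_zero (hrank.trans Matrix.rank_zero))
      by_cases hnm : 0 < n ∨ 0 < m
      · obtain ⟨M, hM⟩ := exists_path_oneBlock hnm hA
        obtain ⟨M', hM'⟩ := exists_path_oneBlock hnm hA'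
        refine hM.trans (.trans (ElementaryPath.oneBlock (ih M M' ?_ ?_)) hM'.symm)
        · have := hM.rank_eq.symm.trans (hrank.trans hM'.rank_eq)
          simpa [rank_oneBlock] using this
        · rintro rfl
          have := hdet rfl
          simp only [Fin.cast_refl, Matrix.submatrix_id_id] at this ⊢
          rw [← det_oneBlock, ← det_oneBlock M', ← hM.det_eq, ← hM'.det_eq, this]
      -- A `1 × 1` matrix admits no operations; here the determinant alone forces equality.
      · obtain ⟨rfl, rfl⟩ : n = 0 ∧ m = 0 := by omega
        have hdet' : A 0 0 = A' 0 0 := by simpa using hdet rfl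
        have : A = A' := by
          ext i j
          rw [Fin.fin_one_eq_zero i, Fin.fin_one_eq_zero j]
          exact hdet'
        rw [this]
        exact .refl

end Elimination

/-! ### Moving finitely many matrices by means of generic shears -/

section Transitivity

variable {k : Type*} [Field k]

/-- A coefficient depends only on the rows or columns left unchanged, so it can be read off from the
output and the operation undone. -/
theorem ElementaryMap.injective {n m : ℕ}
    {f : Matrix (Fin n) (Fin m) k → Matrix (Fin n) (Fin m) k} (hf : ElementaryMap f) :
    Function.Injective f := by
  induction hf with
  | id => exact fun _ _ h => h
  | @row f _ r s h F hF ih =>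
    intro A B hAB
    have hrow : ∀ i q, i ≠ r → f A i q = f B i q := fun i q hi => by
      have := congrFun (congrFun hAB i) q
      simpa [hi] using this
    have hAB' := congrArg (Matrix.transvection r s (-F (f A)) * ·) hAB
    simp only [← hF _ _ hrow] at hAB'
    simp only [← Matrix.mul_assoc, Matrix.transvection_mul_transvection_same _ _ h] at hAB'
    exact ih (by simpa using hAB')
  | @col f _ r s h F hF ih =>
    intro A B hAB
    have hcol : ∀ i q, q ≠ s → f A i q = f B i q := fun i q hi => by
      have := congrFun (congrFun hAB i) q
      simpa [hi] using this
    have hAB' := congrArg (· * Matrix.transvection r s (-F (f A))) hAB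
    simp only [← hF _ _ hcol] at hAB'
    simp only [Matrix.mul_assoc, Matrix.transvection_mul_transvection_same _ _ h] at hAB'
    exact ih (by simpa using hAB')

theorem ElementaryMap.elementaryPath {n m : ℕ}
    {f : Matrix (Fin n) (Fin m) k → Matrix (Fin n) (Fin m) k} (hf : ElementaryMap f)
    (B : Matrix (Fin n) (Fin m) k) : ElementaryPath B (f B) := by
  induction hf with
  | id => exact .refl
  | row _ r s h F _ ih => exact ih.trans (.row _ h _)
  | col _ r s h F _ ih => exact ih.trans (.col _ h _)

variable {n m : ℕ}

/-- The row vector `(1, x, x², …) B`. -/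
def powRow (x : k) (B : Matrix (Fin n) (Fin m) k) (q : Fin m) : k :=
  ∑ i : Fin n, x ^ (i : ℕ) * B i q

theorem powRow_sub (x : k) (A B : Matrix (Fin n) (Fin m) k) (q : Fin m) :
    powRow x (A - B) q = powRow x A q - powRow x B q := by
  simp [powRow, mul_sub]

/-- The entries of column `q` are the coefficients of `powRow x B q` as a polynomial in `x`, and a
nonzero polynomial has finitely many roots. -/
theorem eventually_cofinite_powRow_ne_zero (B : Matrix (Fin n) (Fin m) k) {i : Fin n} {q : Fin m}
    (h : B i q ≠ 0) : ∀ᶠ x in Filter.cofinite, powRow x B q ≠ 0 := by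
  classical
  obtain ⟨p, hp⟩ : ∃ p : Polynomial k,
      p = ∑ i : Fin n, Polynomial.C (B i q) * Polynomial.X ^ (i : ℕ) := ⟨_, rfl⟩
  have hcoeff : p.coeff i = B i q := by
    rw [hp, Polynomial.finsetSum_coeff, Finset.sum_eq_single i]
    · simp
    · intro j _ hj
      rw [Polynomial.coeff_C_mul, Polynomial.coeff_X_pow, if_neg (Fin.val_ne_of_ne hj.symm),
        mul_zero]
    · simp
  have hp0 : p ≠ 0 := by
    rintro rfl
    exact h (by rw [← hcoeff, Polynomial.coeff_zero])
  refine (p.roots.toFinset.finite_toSet).subset fun x hx => ?_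
  have hx' : powRow x B q = 0 := by simpa using hx
  have : p.eval x = 0 := by
    rw [hp, Polynomial.eval_finsetSum, ← hx', powRow]
    refine Finset.sum_congr rfl fun i _ => ?_
    rw [Polynomial.eval_mul, Polynomial.eval_C, Polynomial.eval_pow, Polynomial.eval_X, mul_comm]
  simpa [hp0] using this

theorem eventually_cofinite_ne_add_mul {a : k} (ha : a ≠ 0) (b c : k) :
    ∀ᶠ t in Filter.cofinite, b ≠ c + t * a := by
  refine (Set.finite_singleton ((b - c) / a)).subset fun t ht => ?_
  have : b = c + t * a := by simpa using ht
  rw [Set.mem_singleton_iff, this]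
  field_simp
  ring

theorem ElementaryMap.addRows (η : Fin n → k) (S : Finset (Fin n)) :
    ElementaryMap fun B : Matrix (Fin (n + 1)) (Fin m) k =>
      Matrix.of fun i q => B i q + if i = 0 then ∑ j ∈ S, η j * B j.succ q else 0 := by
  induction S using Finset.induction_on with
  | empty =>
    convert ElementaryMap.id using 2
    ext i q
    simp
  | insert j S hj ih =>
    convert ih.row 0 j.succ (Fin.succ_ne_zero j).symm (fun _ => η j) (fun _ _ _ => rfl) using 2
    ext i q
    by_cases hi : i = 0
    · subst hi
      simp [Finset.sum_insert hj]
      ring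
    · simp [hi]

/-- The shear `B + t w ψ B`, where `ψ = (1, x, x², …)` and `w = e₁ - x e₀`. -/
def shear (x t : k) (B : Matrix (Fin (n + 2)) (Fin m) k) : Matrix (Fin (n + 2)) (Fin m) k :=
  Matrix.of fun i q => B i q + t * ((if i = 0 then -x else if i = 1 then 1 else 0) * powRow x B q)

/-- This is `ψ w = -x + x = 0`. It makes the shear with `-t` inverse to that with `t`, and lets `ψ`
separate points before and after shearing. -/
theorem powRow_shear (x t : k) (B : Matrix (Fin (n + 2)) (Fin m) k) (q : Fin m) :
    powRow x (shear x t B) q = powRow x B q := by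
  have h : powRow x (shear x t B) q = ∑ i : Fin (n + 2), x ^ (i : ℕ) *
      (B i q + t * ((if i = 0 then -x else if i = 1 then 1 else 0) * powRow x B q)) := rfl
  simp only [h, mul_add, Finset.sum_add_distrib]
  rw [← powRow, add_eq_left, Fin.sum_univ_succ, Fin.sum_univ_succ]
  simp [Fin.succ_ne_zero, Fin.succ_succ_ne_one]
  ring

theorem shear_neg_shear (x t : k) (B : Matrix (Fin (n + 2)) (Fin m) k) :
    shear x (-t) (shear x t B) = B := by
  ext i q
  rw [shear, Matrix.of_apply, powRow_shear, shear, Matrix.of_apply]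
  ring

/-- Some elementary map fixes `A` and acts as a shear on every `C` with `ψ C ≠ ψ A`. -/
theorem exists_elementaryMap_shear (x t : k) (A : Matrix (Fin (n + 2)) (Fin m) k) :
    ∃ f : Matrix (Fin (n + 2)) (Fin m) k → Matrix (Fin (n + 2)) (Fin m) k,
      ElementaryMap f ∧ f A = A ∧
        ∀ C, (∃ q, powRow x A q ≠ powRow x C q) → f C = shear x t C := by
  classical
  -- `P 1` turns row `0` into `ψ B`, and `P (-1)` is its inverse. Conjugating by `P 1` the operation
  -- that adds `t` times row `0` to row `1` gives the shear.
  let P : k → Matrix (Fin (n + 2)) (Fin m) k → Matrix (Fin (n + 2)) (Fin m) k := fun c B =>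
    Matrix.of fun i q => B i q +
      if i = 0 then ∑ j : Fin (n + 1), c * x ^ ((j : ℕ) + 1) * B j.succ q else 0
  have hP : ∀ c, ElementaryMap (P c) := fun c => ElementaryMap.addRows _ _
  have hP0 : ∀ B q, P 1 B 0 q = powRow x B q := fun B q => by
    simp [P, powRow, Fin.sum_univ_succ (n := n + 1)]
  have hcomp : ∀ c B, P (-1) (Matrix.transvection (1 : Fin (n + 2)) 0 c * P 1 B) = shear x c B := by
    intro c B
    ext i q
    have h1 : ∀ i : Fin (n + 2), i ≠ 0 → P 1 B i q = B i q := fun i hi => by simp [P, hi]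
    have hv : ((1 : Fin (n + 2)) : ℕ) = 1 := rfl
    have h10 : (1 : Fin (n + 2)) ≠ 0 := by simp
    have h2 : ∀ j : Fin n, (Matrix.transvection (1 : Fin (n + 2)) 0 c * P 1 B) j.succ.succ q = B j.succ.succ q :=
      fun j => by
        rw [Matrix.transvection_mul_apply_of_ne _ _ _ _ (by simp [Fin.ext_iff]),
          h1 _ (Fin.succ_ne_zero _)]
    have h3 : (Matrix.transvection (1 : Fin (n + 2)) 0 c * P 1 B) 1 q = B 1 q + c * powRow x B q := by
      rw [Matrix.transvection_mul_apply_same, h1 _ h10, hP0]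
    have h4 : (Matrix.transvection (1 : Fin (n + 2)) 0 c * P 1 B) 0 q = powRow x B q := by
      rw [Matrix.transvection_mul_apply_of_ne _ _ _ _ h10.symm, hP0]
    change (Matrix.transvection (1 : Fin (n + 2)) 0 c * P 1 B) i q + (if i = 0 then _ else _) = _
    refine Fin.cases ?_ (fun i => Fin.cases ?_ (fun i => ?_) i) i
    · rw [if_pos rfl, h4, Fin.sum_univ_succ]
      simp only [h2, Fin.succ_zero_eq_one, h3]
      simp only [shear, Matrix.of_apply, if_true, powRow, Fin.sum_univ_succ (n := n + 1),
        Fin.sum_univ_succ (n := n)]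
      simp only [hv, Fin.val_zero, Fin.val_succ, Fin.succ_zero_eq_one, neg_mul, one_mul,
        Finset.sum_neg_distrib]
      ring
    · simp [h3, shear]
    · rw [h2]
      simp [shear, Fin.succ_succ_ne_one]
  -- The coefficient is switched off at matrices agreeing with `P 1 A` outside row `1`. Row `0` of
  -- `P 1 C` is `ψ C`, so `ψ C ≠ ψ A` keeps it switched on at `C`.
  refine ⟨_, (hP (-1)).comp ((hP 1).row 1 0 (by simp)
    (fun M => if ∀ i q, i ≠ 1 → M i q = P 1 A i q then 0 else t) ?_), ?_, ?_⟩
  · intro M M' h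
    refine if_congr ?_ rfl rfl
    exact forall_congr' fun i => forall_congr' fun q => imp_congr_right fun hi => by rw [h i q hi]
  · simp only [hcomp]
    ext i q
    simp [shear]
  · rintro C ⟨q, hq⟩
    simp only [hcomp]
    rw [if_neg]
    intro h
    have := h 0 q (by simp)
    rw [hP0, hP0] at this
    exact hq this.symm

/-- The coefficient is `c` times the indicator of agreement with `A` off row `r`, which is a
legitimate coefficient since it ignores row `r`. -/
theorem exists_elementaryMap_row {r s : Fin n} (h : r ≠ s) (c : k)
    (A : Matrix (Fin n) (Fin m) k) :
    ∃ f : Matrix (Fin n) (Fin m) k → Matrix (Fin n) (Fin m) k,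
      ElementaryMap f ∧ f A = Matrix.transvection r s c * A ∧
        ∀ C, (∃ i q, i ≠ r ∧ A i q ≠ C i q) → f C = C := by
  classical
  refine ⟨_, ElementaryMap.id.row r s h (fun M => if ∀ i q, i ≠ r → M i q = A i q then c else 0)
    ?_, ?_, ?_⟩
  · intro M M' h
    refine if_congr ?_ rfl rfl
    exact forall_congr' fun i => forall_congr' fun q => imp_congr_right fun hi => by rw [h i q hi]
  · simp
  · rintro C ⟨i, q, hi, hne⟩
    have : ¬∀ i q, i ≠ r → C i q = A i q := fun h => hne (h i q hi).symm
    simp [if_neg this]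

theorem exists_elementaryMap_col {r s : Fin m} (h : r ≠ s) (c : k)
    (A : Matrix (Fin n) (Fin m) k) :
    ∃ f : Matrix (Fin n) (Fin m) k → Matrix (Fin n) (Fin m) k,
      ElementaryMap f ∧ f A = A * Matrix.transvection r s c ∧
        ∀ C, (∃ i q, q ≠ s ∧ A i q ≠ C i q) → f C = C := by
  classical
  refine ⟨_, ElementaryMap.id.col r s h (fun M => if ∀ i q, q ≠ s → M i q = A i q then c else 0)
    ?_, ?_, ?_⟩
  · intro M M' h
    refine if_congr ?_ rfl rfl
    exact forall_congr' fun i => forall_congr' fun q => imp_congr_right fun hi => by rw [h i q hi]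
  · simp
  · rintro C ⟨i, q, hi, hne⟩
    have : ¬∀ i q, q ≠ s → C i q = A i q := fun h => hne (h i q hi).symm
    simp [if_neg this]

theorem eventually_cofinite_ne_shear {x : k} {C : Matrix (Fin (n + 2)) (Fin m) k} {i : Fin (n + 2)}
    {q : Fin m} (hi : (if i = 0 then -x else if i = 1 then 1 else 0) ≠ 0) (hq : powRow x C q ≠ 0)
    (a : k) : ∀ᶠ t in Filter.cofinite, a ≠ shear x t C i q :=
  eventually_cofinite_ne_add_mul (mul_ne_zero hi hq) _ _

theorem shear_apply_of_col_eq_zero (x t : k) {C : Matrix (Fin (n + 2)) (Fin m) k} {q : Fin m}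
    (h : ∀ i, C i q = 0) (i : Fin (n + 2)) : shear x t C i q = 0 := by
  simp [shear, powRow, h]

/-- Each step of the path excludes finitely many `t`. By `hS`, `ψ` does not vanish on a nonzero
column of `C ∈ S`, so the entries of that column in rows `0` and `1` of the sheared matrix are
nonconstant affine functions of `t`; zero columns stay zero. -/
theorem eventually_exists_elementaryMap_of_path {x : k} (hx : x ≠ 0)
    (S : Finset (Matrix (Fin (n + 2)) (Fin m) k))
    (hS : ∀ C ∈ S, ∀ q, powRow x C q = 0 → ∀ i, C i q = 0)
    {A A' : Matrix (Fin (n + 2)) (Fin m) k} (h : ElementaryPath A A') :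
    ∀ᶠ t in Filter.cofinite, ∃ f : Matrix (Fin (n + 2)) (Fin m) k → Matrix (Fin (n + 2)) (Fin m) k,
      ElementaryMap f ∧ f A = A' ∧ ∀ C ∈ S, f (shear x t C) = shear x t C := by
  induction h with
  | refl => exact .of_forall fun t => ⟨_, .id, rfl, fun _ _ => rfl⟩
  | @tail M M' _ hs ih =>
    suffices hstep : ∀ᶠ t in Filter.cofinite,
        ∃ f : Matrix (Fin (n + 2)) (Fin m) k → Matrix (Fin (n + 2)) (Fin m) k,
          ElementaryMap f ∧ f M = M' ∧ ∀ C ∈ S, f (shear x t C) = shear x t C by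
      filter_upwards [ih, hstep] with t ⟨f, hf, hfA, hfS⟩ ⟨g, hg, hgM, hgS⟩
      exact ⟨_, hg.comp hf, by rw [hfA, hgM], fun C hC => by rw [hfS C hC, hgS C hC]⟩
    by_cases hM : M = M'
    · exact .of_forall fun t => ⟨_, .id, hM, fun _ _ => rfl⟩
    rcases hs with ⟨r, s, h, c, rfl⟩ | ⟨r, s, h, c, rfl⟩
    -- A nontrivial step needs a nonzero row `s`. As row `s` is not changed, this entry separates
    -- `M` from the zero matrix.
    · obtain ⟨p, hp⟩ : ∃ p, M s p ≠ 0 := by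
        by_contra! h0
        refine hM (Matrix.ext fun i q => ?_)
        by_cases hi : i = r
        · subst hi
          simp [h0]
        · simp [hi]
      obtain ⟨f, hf, hfM, hfC⟩ := exists_elementaryMap_row h c M
      have : ∀ᶠ t in Filter.cofinite, ∀ C ∈ S, ∃ i q, i ≠ r ∧ M i q ≠ shear x t C i q := by
        refine (Filter.eventually_all_finset S).mpr fun C hC => ?_
        by_cases hC0 : ∀ q, powRow x C q = 0
        · refine .of_forall fun t => ⟨s, p, h.symm, ?_⟩
          rwa [shear_apply_of_col_eq_zero x t (hS C hC p (hC0 p))]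
        · push Not at hC0
          obtain ⟨q, hq⟩ := hC0
          -- The vector `w` is nonzero in rows `0` and `1`, and at least one of them is not `r`.
          obtain ⟨i, hir, hi⟩ : ∃ i : Fin (n + 2), i ≠ r ∧
              (if i = 0 then -x else if i = 1 then 1 else 0) ≠ 0 := by
            by_cases hr : r = 0
            · exact ⟨1, by simp [hr], by simp⟩
            · exact ⟨0, Ne.symm hr, by simpa using hx⟩
          exact (eventually_cofinite_ne_shear hi hq _).mono fun t ht => ⟨i, q, hir, ht⟩
      exact this.mono fun t ht => ⟨f, hf, hfM, fun C hC => hfC _ (ht C hC)⟩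
    · obtain ⟨p, hp⟩ : ∃ p, M p r ≠ 0 := by
        by_contra! h0
        refine hM (Matrix.ext fun i q => ?_)
        by_cases hi : q = s
        · subst hi
          simp [h0]
        · simp [hi]
      obtain ⟨f, hf, hfM, hfC⟩ := exists_elementaryMap_col h c M
      have : ∀ᶠ t in Filter.cofinite, ∀ C ∈ S, ∃ i q, q ≠ s ∧ M i q ≠ shear x t C i q := by
        refine (Filter.eventually_all_finset S).mpr fun C hC => ?_
        -- Column `r` is not changed and is nonzero in `M`: it separates `M` from `C` either by
        -- vanishing in `C` or by varying with `t`.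
        by_cases hC0 : powRow x C r = 0
        · refine .of_forall fun t => ⟨p, r, h, ?_⟩
          rwa [shear_apply_of_col_eq_zero x t (hS C hC r hC0)]
        · exact (eventually_cofinite_ne_shear (i := 1) (by simp) hC0 _).mono
            fun t ht => ⟨1, r, h, ht⟩
      exact this.mono fun t ht => ⟨f, hf, hfM, fun C hC => hfC _ (ht C hC)⟩

/-- For generic `x`, `ψ` separates `A` and `A'` from `S` and kills no nonzero column of a member of
`S`; then `t` is taken generic. The path map is put between a shear fixing `A` and the inverse shear
fixing `A'`. -/
theorem exists_elementaryMap_fixing_of_two_le_rows [Infinite k]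
    (S : Finset (Matrix (Fin (n + 2)) (Fin m) k))
    {A A' : Matrix (Fin (n + 2)) (Fin m) k} (hA : A ∉ S) (hA' : A' ∉ S) (h : ElementaryPath A A') :
    ∃ f : Matrix (Fin (n + 2)) (Fin m) k → Matrix (Fin (n + 2)) (Fin m) k,
      ElementaryMap f ∧ f A = A' ∧ ∀ C ∈ S, f C = C := by
  have hne : ∀ B : Matrix (Fin (n + 2)) (Fin m) k, B ∉ S →
      ∀ᶠ x in Filter.cofinite, ∀ C ∈ S, ∃ q, powRow x B q ≠ powRow x C q := by
    intro B hB
    refine (Filter.eventually_all_finset S).mpr fun C hC => ?_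
    obtain ⟨i, q, hiq⟩ : ∃ i q, (B - C) i q ≠ 0 := by
      by_contra! h0
      exact hB (sub_eq_zero.mp (Matrix.ext h0) ▸ hC)
    exact (eventually_cofinite_powRow_ne_zero (B - C) hiq).mono fun x hx =>
      ⟨q, by rwa [powRow_sub, sub_ne_zero] at hx⟩
  have hS : ∀ᶠ x in Filter.cofinite, ∀ C ∈ S, ∀ q, powRow x C q = 0 → ∀ i, C i q = 0 := by
    refine (Filter.eventually_all_finset S).mpr fun C _ => Filter.eventually_all.mpr fun q => ?_
    by_cases h0 : ∀ i, C i q = 0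
    · exact .of_forall fun _ _ => h0
    · push Not at h0
      exact (eventually_cofinite_powRow_ne_zero C h0.choose_spec).mono fun x hx h => absurd h hx
  have hx0 : ∀ᶠ x : k in Filter.cofinite, x ≠ 0 := (Set.finite_singleton 0).eventually_cofinite_notMem
  obtain ⟨x, hx0, hxS, hxA, hxA'⟩ := (hx0.and (hS.and ((hne A hA).and (hne A' hA')))).exists
  obtain ⟨t, f, hf, hfA, hfS⟩ := (eventually_exists_elementaryMap_of_path hx0 S hxS h).exists
  obtain ⟨g, hg, hgA, hgS⟩ := exists_elementaryMap_shear x t A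
  obtain ⟨g', hg', hgA', hgS'⟩ := exists_elementaryMap_shear x (-t) A'
  refine ⟨_, hg'.comp (hf.comp hg), by rw [hgA, hfA, hgA'], fun C hC => ?_⟩
  rw [hgS C (hxA C hC), hfS C hC, hgS', shear_neg_shear]
  simpa only [powRow_shear] using hxA' C hC

/-- A matrix can be moved along any elementary path, avoiding and fixing finitely many others. -/
theorem exists_elementaryMap_fixing [Infinite k] (hnm : 2 ≤ m * n)
    (S : Finset (Matrix (Fin n) (Fin m) k)) {A A' : Matrix (Fin n) (Fin m) k} (hA : A ∉ S)
    (hA' : A' ∉ S) (h : ElementaryPath A A') :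
    ∃ f : Matrix (Fin n) (Fin m) k → Matrix (Fin n) (Fin m) k,
      ElementaryMap f ∧ f A = A' ∧ ∀ C ∈ S, f C = C := by
  classical
  match n, m with
  | n + 2, m => exact exists_elementaryMap_fixing_of_two_le_rows S hA hA' h
  | n, m + 2 =>
    obtain ⟨f, hf, hfA, hfS⟩ := exists_elementaryMap_fixing_of_two_le_rows
      (S.image Matrix.transpose) (A := A.transpose) (A' := A'.transpose)
      (by simpa [Matrix.transpose_inj] using hA) (by simpa [Matrix.transpose_inj] using hA')
      h.transpose
    refine ⟨_, hf.transpose, by rw [hfA, Matrix.transpose_transpose], fun C hC => ?_⟩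
    rw [hfS _ (Finset.mem_image_of_mem _ hC), Matrix.transpose_transpose]
  | 0, 0 | 0, 1 | 1, 0 | 1, 1 => omega

/-- Points are placed one by one. Injectivity keeps the next point off the targets already occupied,
and it is still joined to its own target because elementary maps move points along elementary paths.
-/
theorem exists_elementaryMap_forall_eq [Infinite k] {ι : Type*} [Finite ι] (hnm : 2 ≤ m * n)
    {B B' : ι → Matrix (Fin n) (Fin m) k} (hB : Function.Injective B)
    (hB' : Function.Injective B') (h : ∀ i, ElementaryPath (B i) (B' i)) :
    ∃ f : Matrix (Fin n) (Fin m) k → Matrix (Fin n) (Fin m) k,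
      ElementaryMap f ∧ ∀ i, f (B i) = B' i := by
  classical
  have := Fintype.ofFinite ι
  suffices hT : ∀ T : Finset ι, ∃ f : Matrix (Fin n) (Fin m) k → Matrix (Fin n) (Fin m) k,
      ElementaryMap f ∧ ∀ i ∈ T, f (B i) = B' i by
    obtain ⟨f, hf, hfB⟩ := hT Finset.univ
    exact ⟨f, hf, fun i => hfB i (Finset.mem_univ i)⟩
  intro T
  induction T using Finset.induction_on with
  | empty => exact ⟨_, .id, by simp⟩
  | insert j T hj ih =>
    obtain ⟨f, hf, hfT⟩ := ih
    have hfj : f (B j) ∉ T.image B' := fun hmem => by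
      obtain ⟨i, hi, hij⟩ := Finset.mem_image.mp hmem
      rw [← hfT i hi] at hij
      exact hj (hB (hf.injective hij) ▸ hi)
    have hBj : B' j ∉ T.image B' := fun hmem => by
      obtain ⟨i, hi, hij⟩ := Finset.mem_image.mp hmem
      exact hj (hB' hij ▸ hi)
    obtain ⟨g, hg, hgj, hgT⟩ := exists_elementaryMap_fixing hnm (T.image B') hfj hBj
      ((hf.elementaryPath _).symm.trans (h j))
    refine ⟨_, hg.comp hf, fun i hi => ?_⟩
    rcases Finset.mem_insert.mp hi with rfl | hi
    · exact hgj
    · rw [hfT i hi, hgT _ (Finset.mem_image_of_mem _ hi)]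

end Transitivity

theorem theorem3p3 {k : Type*} [Field k] [IsAlgClosed k] [CharZero k] (n m : ℕ)
    (hnm : 2 ≤ m * n) (N : ℕ) (B B' : Fin N → Matrix (Fin n) (Fin m) k)
    (hB : Function.Injective B) (hB' : Function.Injective B')
    (hrank : ∀ i, (B i).rank = (B' i).rank)
    (hdet : ∀ h : n = m, ∀ i,
      ((B i).submatrix id (Fin.cast h)).det = ((B' i).submatrix id (Fin.cast h)).det) :
    ∃ g ∈ elementaryGroup k n m, ∀ i, applyAut g (B i) = B' i := by
  obtain ⟨f, hf, hfB⟩ := exists_elementaryMap_forall_eq hnm hB hB' fun i =>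
    ElementaryPath.of_rank_eq (B i) (B' i) (hrank i) fun h => hdet h i
  obtain ⟨g, hg, hgB⟩ := hf.exists_applyAut_eq B
  exact ⟨g, hg, fun i => (hgB i).trans (hfB i)⟩
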